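/- Let $\mathscr{H}$ be a complex Hilbert space and let $T \in \mathscr{B}(\mathscr{H})$ be a left invertible Fredholm operator with index $\mathrm{ind}(T) = \dim\ker T - \dim\ker T^* = -n$ for some positive integer $n$. Assume that $T$ is analytic, that is, $\bigcap_{k\ge 1} T^k\mathscr{H} = \{0\}$. Let $T^\dagger$ be the Moore--Penrose inverse of $T$: the unique bounded operator with $\ker T^\dagger = (\mathrm{ran}\,T)^\perp$ and $T^\dagger T x = x$ for $x\in(\ker T)^\perp$. Put $\Omega_T = \{z\in\mathbb{C} : |z| < \|T^\dagger\|^{-1}\}$. Call $\gamma:\Omega_T\to\mathscr{H}$ a spanning holomorphic cross-section for $T^*$ if $\gamma$ is holomorphic, $\gamma(\lambda)\in\ker(T^*-\lambda)$ for all $\lambda\in\Omega_T$, and $\overline{\mathrm{span}}\{\gamma(\lambda):\lambda\in\Omega_T\}=\mathscr{H}$. Then: 1. A spanning holomorphic cross-section $\gamma$ for $T^*$ over $\Omega_T$ exists. 2. For every such $\gamma$, the functions $\hat f(\lambda)=\langle f,\gamma(\overline{\lambda})\rangle$, $\lambda \in\Omega_T$, $f\in\mathscr{H}$ (inner product linear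 in the first variable), are analytic on $\Omega_T$, and they form a reproducing kernel Hilbert space $\widehat{\mathscr{H}}_\gamma$ of analytic functions on $\Omega_T$ for which $U: f\mapsto\hat f$ is a unitary $\mathscr{H}\to\widehat{\mathscr{H}}_\gamma$. Multiplication by the independent variable, $(M_z g)(\lambda)=\lambda g(\lambda)$, is a bounded operator on $\widehat{\mathscr{H}}_\gamma$, and $U T U^* = M_z$. In particular, $T$ is unitarily equivalent to $M_z$ on a reproducing kernel Hilbert space of analytic functions on $\Omega_T$. 3. In each such model, $U T^\dagger U^* = M_z^\dagger$, and $M_z^\dagger$ is division by $z$ on the orthogonal complement of its kernel: for $g\in(\ker M_z^\dagger)^\perp$ one has $\lambda\,(M_z^\dagger g)(\lambda) = g(\lambda)$ for all $\lambda\in\Omega_T$. -/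

import Mathlib

open scoped ComplexConjugate InnerProductSpace

universe u

section

variable {H : Type u} [NormedAddCommGroup H] [InnerProductSpace ℂ H]

/-- `S` is a Moore-Penrose inverse of `T`: `ker S = (ran T)ᗮ`, and `S` inverts `T` on
`(ker T)ᗮ`. -/
def IsMoorePenroseInverse (T S : H →L[ℂ] H) : Prop :=
  S.ker = T.rangeᗮ ∧ ∀ x ∈ T.kerᗮ, S (T x) = x

/-- A Moore-Penrose inverse is unique, so the choice in `moorePenrose` is no choice. -/
theorem IsMoorePenroseInverse.unique [CompleteSpace H] {T S S' : H →L[ℂ] H}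
    (h : IsMoorePenroseInverse T S) (h' : IsMoorePenroseInverse T S') : S = S' := by
  have hrange : ∀ x, S (T x) = S' (T x) := by
    intro x
    have : CompleteSpace T.ker := T.isClosed_ker.completeSpace_coe
    obtain ⟨y, hy, z, hz, hx⟩ := Submodule.exists_add_mem_mem_orthogonal (K := T.ker) x
    have hy0 : T y = 0 := hy
    simp [hx, hy0, h.2 z hz, h'.2 z hz]
  have hker : T.range ⊔ T.rangeᗮ ≤ (S - S').ker := by
    refine sup_le ?_ ?_
    · rintro _ ⟨x, rfl⟩
      simpa [sub_eq_zero] using hrange x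
    · intro x hx
      have h1 : x ∈ S.ker := h.1 ▸ hx
      have h2 : x ∈ S'.ker := h'.1 ▸ hx
      simp only [LinearMap.mem_ker, ContinuousLinearMap.coe_coe] at h1 h2
      simp [h1, h2]
  have hclosed : (T.range ⊔ T.rangeᗮ).topologicalClosure ≤ (S - S').ker :=
    Submodule.topologicalClosure_minimal _ hker (S - S').isClosed_ker
  have htop : (T.range ⊔ T.rangeᗮ).topologicalClosure = ⊤ := by
    rw [Submodule.topologicalClosure_eq_top_iff, ← Submodule.inf_orthogonal]
    exact Submodule.inf_orthogonal_eq_bot _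
  ext x
  have hx : x ∈ (S - S').ker := hclosed (htop ▸ Submodule.mem_top)
  simpa [sub_eq_zero] using hx

open Classical in
/-- The Moore-Penrose inverse `T†` of an operator `T`. It exists exactly when `T` has closed
range; otherwise the value is `0`. -/
noncomputable def moorePenrose (T : H →L[ℂ] H) : H →L[ℂ] H :=
  if h : ∃ S, IsMoorePenroseInverse T S then h.choose else 0

/-- `T` is analytic: `⋂_{k ≥ 1} T ^ k H = 0`. -/
def IsAnalyticOperator (T : H →L[ℂ] H) : Prop :=
  ⨅ k : {k : ℕ // 1 ≤ k}, (T ^ (k : ℕ)).range = ⊥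

/-- The index `dim (ker T) - dim (ker T*)` of a Fredholm operator `T`. -/
noncomputable def fredholmIndex [CompleteSpace H] (T : H →L[ℂ] H) : ℤ :=
  (Module.finrank ℂ T.ker : ℤ) - (Module.finrank ℂ T.adjoint.ker : ℤ)

/-- The disc `Ω_T = {z : |z| < ‖T†‖⁻¹}`. -/
def omegaDisc (T : H →L[ℂ] H) : Set ℂ :=
  {z : ℂ | ‖z‖ < ‖moorePenrose T‖⁻¹}

/-- A spanning holomorphic cross-section over `Ω` of the bundle of eigenspaces of `R`:
`γ` is holomorphic on `Ω`, `γ z ∈ ker (R - z)` for `z ∈ Ω`, and the vectors `γ z`, `z ∈ Ω`, have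
dense linear span. -/
structure IsSpanningSection (R : H →L[ℂ] H) (Ω : Set ℂ) (γ : ℂ → H) : Prop where
  holomorphic : AnalyticOnNhd ℂ γ Ω
  eigenvector : ∀ z ∈ Ω, R (γ z) = z • γ z
  spanning : (Submodule.span ℂ (γ '' Ω)).topologicalClosure = ⊤

/-- A function defined on the points of `Ω` is analytic. -/
def IsAnalyticFunction {Ω : Set ℂ} (f : Ω → ℂ) : Prop :=
  ∃ F : ℂ → ℂ, AnalyticOnNhd ℂ F Ω ∧ ∀ z : Ω, F z = f z

end

/-! Put `S` = T† and `A` = S*. Left invertibility gives S T = 1, hence T* A = 1, so for e in ker T*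
the vector (1 - zA)⁻¹ e solves T* v = z v whenever |z| < R = ‖A‖⁻¹. With generators e_i of ker T*,
the section is γ(z) = Σ ψ(z)^i (1 - zA)⁻¹ e_i for a suitable scalar function ψ. If f is orthogonal
to every γ(z), then Σ ψ^i g_i = 0, where g_i has Taylor coefficients ⟨f, A^k e_i⟩ = O(R⁻ᵏ) up to
conjugation convention. The holomorphic function ψ has too many zeros for a nonzero series of this
growth to vanish on them: g_0 = 0, one factor ψ cancels, and induction kills every g_i
(`coeff_eq_zero_of_sum_lacunaryProduct_pow`). Hence each S^k f is orthogonal to ker T*, so lies in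
ran T; thus f = T^k S^k f for all k, and analyticity of T forces f = 0. The model is then formal:
spanning makes f ↦ ⟨f, γ(conj ·)⟩ injective, so the Hilbert norm transports to its image; the
eigenvector equation turns T into multiplication by z; Moore-Penrose inverses are unitarily
invariant. -/

/-! ### Uniqueness sets for power series with bounded coefficients. -/

section PowerSeries

open Filter Topology Finset

/-- If a power series with coefficients bounded by `C` vanishes at all `m`-th roots of `q ^ m`,
then its coefficients of index `< m` are at most `C * q ^ m / (1 - q)`. -/
theorem norm_coeff_le_of_vanishing_at_roots {b : ℕ → ℂ} {C q : ℝ} (hb : ∀ k, ‖b k‖ ≤ C)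
    (hq0 : 0 < q) (hq1 : q < 1) {m j : ℕ} (hj : j < m)
    (hz : ∀ z : ℂ, z ^ m = (q : ℂ) ^ m → ∑' k, b k * z ^ k = 0) :
    ‖b j‖ ≤ C * q ^ m / (1 - q) := by
  have hm : m ≠ 0 := by omega
  have hmpos : (0 : ℝ) < m := by positivity
  obtain ⟨ζ, hζ⟩ : ∃ ζ : ℂ, IsPrimitiveRoot ζ m := ⟨_, Complex.isPrimitiveRoot_exp m hm⟩
  have hζn : ‖ζ‖ = 1 := hζ.norm'_eq_one hm
  -- Root-of-unity filter: summing over the points q ζ^t with weights ζ^((m - j) t) keeps only the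
  -- indices k ≡ j mod m. The shift m - j replaces -j.
  set S : ℕ → ℂ := fun k => ∑ t ∈ range m, (ζ ^ (k + (m - j))) ^ t with hS
  have hSle : ∀ k, ‖S k‖ ≤ m := fun k => by
    refine (norm_sum_le _ _).trans ?_
    simp [hζn]
  have hSj : S j = m := by
    have : ζ ^ (j + (m - j)) = 1 := by rw [show j + (m - j) = m by omega, hζ.pow_eq_one]
    simp [hS, this]
  have hS0 : ∀ k < j + m, k ≠ j → S k = 0 := by
    intro k hk hkj
    have hne : ζ ^ (k + (m - j)) ≠ 1 := by
      rw [Ne, hζ.pow_eq_one_iff_dvd]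
      rintro ⟨c, hc⟩
      have h1 : c ≠ 1 := by rintro rfl; omega
      have h2 : c ≠ 0 := by rintro rfl; omega
      have h3 : 2 * m ≤ m * c := by nlinarith [show 2 ≤ c by omega]
      omega
    simp only [hS]
    rw [geom_sum_eq hne, ← pow_mul, mul_comm, pow_mul, hζ.pow_eq_one]
    simp
  have hgeo : Summable fun k => C * q ^ k :=
    (summable_geometric_of_lt_one hq0.le hq1).mul_left C
  have hsum : ∀ t : ℕ, Summable fun k => b k * ((q : ℂ) * ζ ^ t) ^ k := fun t => by
    refine Summable.of_norm_bounded hgeo fun k => ?_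
    simpa [hζn, abs_of_pos hq0] using
      mul_le_mul_of_nonneg_right (hb k) (pow_nonneg hq0.le k)
  have hterm : ∀ k, b k * (q : ℂ) ^ k * S k
      = ∑ t ∈ range m, ζ ^ ((m - j) * t) * (b k * ((q : ℂ) * ζ ^ t) ^ k) := fun k => by
    rw [hS, mul_sum]
    refine sum_congr rfl fun t _ => ?_
    ring
  have hsumS : Summable fun k => b k * (q : ℂ) ^ k * S k := by
    simp_rw [hterm]
    exact summable_sum fun t _ => (hsum t).mul_left _
  have htot : ∑' k, b k * (q : ℂ) ^ k * S k = 0 := by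
    simp_rw [hterm]
    rw [Summable.tsum_finsetSum fun t _ => (hsum t).mul_left _]
    refine sum_eq_zero fun t _ => ?_
    rw [tsum_mul_left, hz, mul_zero]
    rw [mul_pow, ← pow_mul, mul_comm t, pow_mul, hζ.pow_eq_one, one_pow, mul_one]
  -- After j the next surviving index is j + m, so m b_j q^j is minus a tail, dominated by a
  -- geometric series.
  rw [← hsumS.sum_add_tsum_nat_add (j + m), sum_eq_single_of_mem j (by simpa using Nat.pos_of_ne_zero hm)
    (fun k hk hkj => by rw [hS0 k (by simpa using hk) hkj, mul_zero]), hSj,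
    add_eq_zero_iff_eq_neg] at htot
  have hbound : ‖∑' k, b (k + (j + m)) * (q : ℂ) ^ (k + (j + m)) * S (k + (j + m))‖
      ≤ (C * q ^ (j + m) * m) * (1 - q)⁻¹ := by
    refine tsum_of_norm_bounded ((hasSum_geometric_of_lt_one hq0.le hq1).mul_left _) fun k => ?_
    rw [norm_mul, norm_mul, norm_pow, Complex.norm_real, Real.norm_of_nonneg hq0.le]
    calc _ ≤ C * q ^ (k + (j + m)) * m := by
          gcongr
          · exact mul_nonneg ((norm_nonneg _).trans (hb 0)) (by positivity)
          · exact hb _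
          · exact hSle _
      _ = _ := by ring
  have heq : ‖b j‖ * (q ^ j * m) ≤ C * q ^ m / (1 - q) * (q ^ j * m) := by
    calc ‖b j‖ * (q ^ j * m) = ‖b j * (q : ℂ) ^ j * m‖ := by
          simp [abs_of_pos hq0, mul_assoc]
      _ ≤ C * q ^ (j + m) * m * (1 - q)⁻¹ := by rw [htot, norm_neg]; exact hbound
      _ = _ := by ring
  exact le_of_mul_le_mul_right heq (by positivity)

/-- The radii `1 - 1 / (k + 2)` of the zeros of `lacunaryProduct`. -/
noncomputable def zeroRadius (k : ℕ) : ℝ := 1 - 1 / ((k : ℝ) + 2)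

theorem zeroRadius_pos (k : ℕ) : 0 < zeroRadius k := by
  have : 1 / ((k : ℝ) + 2) < 1 := by rw [div_lt_one (by positivity)]; linarith [k.cast_nonneg (α := ℝ)]
  unfold zeroRadius; linarith

theorem zeroRadius_lt_one (k : ℕ) : zeroRadius k < 1 := by
  have : 0 < 1 / ((k : ℝ) + 2) := by positivity
  unfold zeroRadius; linarith

theorem tendsto_zeroRadius : Tendsto zeroRadius atTop (𝓝 1) := by
  have h : Tendsto (fun k : ℕ => 1 / ((k : ℝ) + 2)) atTop (𝓝 0) :=
    tendsto_const_nhds.div_atTop (tendsto_atTop_add_const_right _ _ tendsto_natCast_atTop_atTop)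
  have h' := h.const_sub 1
  rwa [sub_zero] at h'

/-- The exponent (k + 2)² beats 1 - r_k = 1 / (k + 2): r_k to that power is at most exp(-(k + 2)),
while 1 / (1 - r_k) grows only linearly. -/
theorem tendsto_zeroRadius_pow_div :
    Tendsto (fun k => zeroRadius k ^ ((k + 2) ^ 2) / (1 - zeroRadius k)) atTop (𝓝 0) := by
  have h1 : Tendsto (fun k : ℕ => ((k : ℝ) + 2) ^ 1 * Real.exp (-((k : ℝ) + 2))) atTop (𝓝 0) :=
    (Real.tendsto_pow_mul_exp_neg_atTop_nhds_zero 1).comp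
      (tendsto_atTop_add_const_right _ _ tendsto_natCast_atTop_atTop)
  refine squeeze_zero (fun k => ?_) (fun k => ?_) h1
  · have := zeroRadius_pos k
    have := zeroRadius_lt_one k
    have : 0 < 1 - zeroRadius k := by linarith
    positivity
  · have hpos : (0 : ℝ) < (k : ℝ) + 2 := by positivity
    have h2 : zeroRadius k ≤ Real.exp (-(1 / ((k : ℝ) + 2))) := by
      have := Real.add_one_le_exp (-(1 / ((k : ℝ) + 2)))
      unfold zeroRadius; linarith
    have h3 : zeroRadius k ^ ((k + 2) ^ 2) ≤ Real.exp (-((k : ℝ) + 2)) := by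
      refine (pow_le_pow_left₀ (zeroRadius_pos k).le h2 _).trans_eq ?_
      rw [← Real.exp_nat_mul]
      congr 1
      push_cast
      field_simp
    have h4 : 1 - zeroRadius k = 1 / ((k : ℝ) + 2) := by unfold zeroRadius; ring
    rw [h4, div_div_eq_mul_div, div_one, pow_one, mul_comm]
    gcongr

/-- A holomorphic function on the unit disc, with zeros at the `(k + 2) ^ 2`-th roots of
`zeroRadius k ^ (k + 2) ^ 2`. -/
noncomputable def lacunaryProduct (z : ℂ) : ℂ :=
  ∏' k : ℕ, (1 + -(z / zeroRadius k) ^ ((k + 2) ^ 2))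

theorem lacunaryProduct_zero : lacunaryProduct 0 = 1 := by
  simp [lacunaryProduct]

theorem lacunaryProduct_eq_zero {k : ℕ} {z : ℂ}
    (hz : z ^ ((k + 2) ^ 2) = (zeroRadius k : ℂ) ^ ((k + 2) ^ 2)) : lacunaryProduct z = 0 := by
  refine tprod_of_exists_eq_zero ⟨k, ?_⟩
  have h : (zeroRadius k : ℂ) ≠ 0 := mod_cast (zeroRadius_pos k).ne'
  rw [div_pow, hz, div_self (pow_ne_zero _ h), add_neg_cancel]

/-- On |z| < ρ < s < 1, once r_k > ρ / s the k-th term is at most s^((k + 2)²) ≤ s^k, so the product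
converges locally uniformly. -/
theorem differentiableOn_lacunaryProduct :
    DifferentiableOn ℂ lacunaryProduct (Metric.ball 0 1) := by
  intro z hz
  obtain ⟨ρ, hzρ, hρ⟩ := exists_between (mem_ball_zero_iff.1 hz)
  have hρ0 : 0 < ρ := (norm_nonneg z).trans_lt hzρ
  obtain ⟨s, hρs, hs⟩ := exists_between hρ
  have hs0 : 0 < s := hρ0.trans hρs
  have hev : ∀ᶠ k in atTop, ρ / s < zeroRadius k :=
    tendsto_zeroRadius.eventually (lt_mem_nhds (by rwa [div_lt_one hs0]))
  have hloc : DifferentiableOn ℂ lacunaryProduct (Metric.ball 0 ρ) := by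
    have hprod := Summable.hasProdLocallyUniformlyOn_nat_one_add
      (f := fun (k : ℕ) (z : ℂ) => -(z / zeroRadius k) ^ ((k + 2) ^ 2)) (K := Metric.ball 0 ρ)
      Metric.isOpen_ball (summable_geometric_of_lt_one hs0.le hs) ?_ (fun k => by fun_prop)
    · refine hprod.tendstoLocallyUniformlyOn_finsetRange.differentiableOn
        (Eventually.of_forall fun N => ?_) Metric.isOpen_ball
      fun_prop
    · filter_upwards [hev] with k hk w hw
      have hw' : ‖w‖ < ρ := mem_ball_zero_iff.1 hw
      have hq := zeroRadius_pos k
      rw [norm_neg, norm_pow, norm_div, Complex.norm_real, Real.norm_of_nonneg hq.le]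
      have h1 : ‖w‖ / zeroRadius k ≤ s := by
        rw [div_le_iff₀ hq]
        rw [div_lt_iff₀ hs0] at hk
        linarith
      exact (pow_le_pow_left₀ (by positivity) h1 _).trans
        (pow_le_pow_of_le_one hs0.le hs.le (by nlinarith))
  exact ((hloc z (mem_ball_zero_iff.2 hzρ)).differentiableAt
    (Metric.isOpen_ball.mem_nhds (mem_ball_zero_iff.2 hzρ))).differentiableWithinAt

/-- The zeros of `lacunaryProduct` form a uniqueness set for the power series with bounded
coefficients. -/
theorem coeff_eq_zero_of_vanishing_on_zeros {b : ℕ → ℂ} {C : ℝ} (hb : ∀ k, ‖b k‖ ≤ C)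
    (hz : ∀ z : ℂ, ‖z‖ < 1 → lacunaryProduct z = 0 → ∑' k, b k * z ^ k = 0) (j : ℕ) :
    b j = 0 := by
  have hlim := tendsto_zeroRadius_pow_div.const_mul C
  rw [mul_zero] at hlim
  refine norm_le_zero_iff.1 (ge_of_tendsto hlim ?_)
  filter_upwards [eventually_ge_atTop j] with k hk
  rw [← mul_div_assoc]
  refine norm_coeff_le_of_vanishing_at_roots hb (zeroRadius_pos k) (zeroRadius_lt_one k)
    (by nlinarith) fun z hzk => hz z ?_ (lacunaryProduct_eq_zero hzk)
  have h : ‖z‖ ^ ((k + 2) ^ 2) < 1 := by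
    rw [← norm_pow, hzk, norm_pow, Complex.norm_real, Real.norm_of_nonneg (zeroRadius_pos k).le]
    exact pow_lt_one₀ (zeroRadius_pos k).le (zeroRadius_lt_one k) (by positivity)
  exact (pow_lt_one_iff_of_nonneg (norm_nonneg z) (by positivity)).1 h

/-- The powers of `ψ z = lacunaryProduct (z / R)` are linearly independent over the power series
whose coefficients are `O(R⁻ᵏ)`. -/
theorem coeff_eq_zero_of_sum_lacunaryProduct_pow {R : ℝ} (hR : 0 < R) {n : ℕ}
    {g : Fin n → ℂ → ℂ} {a : Fin n → ℕ → ℂ} {C : Fin n → ℝ}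
    (hg : ∀ i, DifferentiableOn ℂ (g i) (Metric.ball 0 R))
    (ha : ∀ i, ∀ z ∈ Metric.ball (0 : ℂ) R, HasSum (fun k => a i k * z ^ k) (g i z))
    (hC : ∀ i k, ‖a i k‖ * R ^ k ≤ C i)
    (h0 : ∀ z ∈ Metric.ball (0 : ℂ) R, ∑ i : Fin n, lacunaryProduct (z / R) ^ (i : ℕ) * g i z = 0)
    (i : Fin n) (k : ℕ) : a i k = 0 := by
  induction n with
  | zero => exact i.elim0
  | succ n ih =>
    have hRC : (R : ℂ) ≠ 0 := mod_cast hR.ne'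
    have hmaps : Set.MapsTo (fun z : ℂ => z / R) (Metric.ball 0 R) (Metric.ball 0 1) := by
      intro z hz
      simpa [abs_of_pos hR, div_lt_one hR] using hz
    have hψ : DifferentiableOn ℂ (fun z : ℂ => lacunaryProduct (z / R)) (Metric.ball 0 R) :=
      differentiableOn_lacunaryProduct.comp (by fun_prop) hmaps
    simp only [Fin.sum_univ_succ, Fin.val_zero, pow_zero, one_mul, Fin.val_succ] at h0
    have ha0 : ∀ k, a 0 k = 0 := by
      intro k
      -- At a zero of ψ only the term i = 0 survives; rescaling by R makes its coefficients bounded.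
      have hb : ∀ k, a 0 k * (R : ℂ) ^ k = 0 := by
        refine coeff_eq_zero_of_vanishing_on_zeros (C := C 0) (fun k => ?_) fun z hz hzero => ?_
        · simpa [abs_of_pos hR] using hC 0 k
        · have hw : (R : ℂ) * z ∈ Metric.ball (0 : ℂ) R := by
            simpa [abs_of_pos hR] using mul_lt_of_lt_one_right hR hz
          have hRz : (R : ℂ) * z / R = z := by field_simp
          have h := h0 _ hw
          simp only [hRz, hzero, ne_eq, Nat.add_eq_zero_iff, one_ne_zero, and_false,
            not_false_eq_true, zero_pow, zero_mul, sum_const_zero, add_zero] at h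
          rw [← h, ← (ha 0 _ hw).tsum_eq]
          exact tsum_congr fun k => by rw [mul_pow]; ring
      exact (mul_eq_zero.1 (hb k)).resolve_right (pow_ne_zero _ hRC)
    have hg0 : ∀ z ∈ Metric.ball (0 : ℂ) R, g 0 z = 0 := fun z hz => by
      rw [← (ha 0 z hz).tsum_eq]
      simp [ha0]
    have hmul : ∀ z ∈ Metric.ball (0 : ℂ) R, lacunaryProduct (z / R) *
        ∑ i : Fin n, lacunaryProduct (z / R) ^ (i : ℕ) * g i.succ z = 0 := fun z hz => by
      rw [← h0 z hz, hg0 z hz, zero_add, mul_sum]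
      exact sum_congr rfl fun i _ => by ring
    have hsumd : DifferentiableOn ℂ
        (fun z : ℂ => ∑ i : Fin n, lacunaryProduct (z / R) ^ (i : ℕ) * g i.succ z)
        (Metric.ball 0 R) :=
      DifferentiableOn.fun_sum fun i _ => (hψ.pow _).mul (hg _)
    -- No zero divisors among analytic functions on a connected set; ψ is not zero since ψ(0) = 1.
    have hcases := AnalyticOnNhd.eq_zero_or_eq_zero_of_mul_eq_zero
      (hψ.analyticOnNhd Metric.isOpen_ball) (hsumd.analyticOnNhd Metric.isOpen_ball) hmul
      (convex_ball (0 : ℂ) R).isPreconnected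
    have hrest := hcases.resolve_left fun h => by
      have := h 0 (Metric.mem_ball_self hR)
      simp [lacunaryProduct_zero] at this
    refine Fin.cases (ha0 k) (fun i => ?_) i
    exact ih (g := fun i => g i.succ) (a := fun i => a i.succ) (C := fun i => C i.succ)
      (fun i => hg _) (fun i => ha _) (fun i => hC _) hrest i

end PowerSeries

/-! ### Moore-Penrose inverses of left invertible operators. -/

section MoorePenrose

variable {H : Type u} [NormedAddCommGroup H] [InnerProductSpace ℂ H]

theorem orthogonal_orthogonal_range [CompleteSpace H] {T : H →L[ℂ] H} (hT : T.HasLeftInverse) :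
    T.rangeᗮᗮ = T.range := by
  rw [Submodule.orthogonal_orthogonal_eq_closure]
  exact IsClosed.submodule_topologicalClosure_eq hT.isClosed_range

theorem inner_eq_zero_of_mem_span {s : Set H} {f : H} (hf : ∀ u ∈ s, ⟪u, f⟫_ℂ = 0) {u : H}
    (hu : u ∈ Submodule.span ℂ s) : ⟪u, f⟫_ℂ = 0 := by
  induction hu using Submodule.span_induction with
  | mem u hu => exact hf u hu
  | zero => simp
  | add u v _ _ hu hv => simp [hu, hv]
  | smul c u _ hu => simp [hu]

theorem IsMoorePenroseInverse.moorePenrose_eq [CompleteSpace H] {T S : H →L[ℂ] H}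
    (h : IsMoorePenroseInverse T S) : moorePenrose T = S := by
  have hex : ∃ S, IsMoorePenroseInverse T S := ⟨S, h⟩
  rw [moorePenrose, dif_pos hex]
  exact hex.choose_spec.unique h

theorem isMoorePenroseInverse_moorePenrose [CompleteSpace H] {T : H →L[ℂ] H} (hT : T.HasLeftInverse) :
    IsMoorePenroseInverse T (moorePenrose T) := by
  suffices h : ∃ S, IsMoorePenroseInverse T S by
    obtain ⟨S, hS⟩ := h
    rwa [hS.moorePenrose_eq]
  obtain ⟨S, hS⟩ := id hT
  have hclosed : IsClosed (T.range : Set H) := hT.isClosed_range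
  have : CompleteSpace T.range := hclosed.completeSpace_coe
  -- Projecting onto the closed range first corrects the kernel of an arbitrary left inverse.
  refine ⟨S ∘L T.range.starProjection, ?_, fun x _ => ?_⟩
  · ext x
    constructor
    · intro hx
      obtain ⟨y, hy⟩ : T.range.starProjection x ∈ T.range :=
        Submodule.starProjection_apply_mem _ _
      have hx' : S (T.range.starProjection x) = 0 := hx
      rw [← hy] at hx'
      have hy0 : y = 0 := (hS y).symm.trans hx'
      rw [← Submodule.starProjection_apply_eq_zero_iff T.range, ← hy, hy0, map_zero]
    · intro hx
      change S (T.range.starProjection x) = 0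
      rw [(Submodule.starProjection_apply_eq_zero_iff T.range).2 hx, map_zero]
  · change S (T.range.starProjection (T x)) = x
    rw [Submodule.starProjection_eq_self_iff.2 (show T x ∈ T.range from ⟨x, rfl⟩)]
    exact hS x

theorem IsMoorePenroseInverse.apply_apply {T S : H →L[ℂ] H} (h : IsMoorePenroseInverse T S)
    (hT : T.HasLeftInverse) (x : H) : S (T x) = x := by
  refine h.2 x ?_
  rw [LinearMap.ker_eq_bot.2 hT.injective, Submodule.bot_orthogonal_eq_top]
  trivial

theorem IsMoorePenroseInverse.conj {K : Type*} [NormedAddCommGroup K] [InnerProductSpace ℂ K]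
    {T S : H →L[ℂ] H} (h : IsMoorePenroseInverse T S) (U : H ≃ₗᵢ[ℂ] K) :
    IsMoorePenroseInverse
      ((U : H →L[ℂ] K) ∘L T ∘L (U.symm : K →L[ℂ] H))
      ((U : H →L[ℂ] K) ∘L S ∘L (U.symm : K →L[ℂ] H)) := by
  refine ⟨?_, fun x hx => ?_⟩
  · ext x
    have hker : U.symm x ∈ S.ker ↔ U.symm x ∈ T.rangeᗮ := by rw [h.1]
    simp only [LinearMap.mem_ker, ContinuousLinearMap.coe_coe, Submodule.mem_orthogonal,
      LinearMap.mem_range, forall_exists_index, forall_apply_eq_imp_iff] at hker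
    simp only [LinearMap.mem_ker, ContinuousLinearMap.coe_coe, Submodule.mem_orthogonal,
      LinearMap.mem_range, forall_exists_index, forall_apply_eq_imp_iff]
    change U (S (U.symm x)) = 0 ↔ ∀ y, ⟪U (T (U.symm y)), x⟫_ℂ = 0
    rw [map_eq_zero_iff U U.injective, hker]
    simp only [LinearIsometryEquiv.inner_map_eq_flip]
    exact ⟨fun hy y => hy _, fun hy y => by simpa using hy (U y)⟩
  · change U (S (U.symm (U (T (U.symm x))))) = x
    rw [U.symm_apply_apply, h.2 _ ?_, U.apply_symm_apply]
    rw [Submodule.mem_orthogonal] at hx ⊢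
    intro y hy
    rw [← U.inner_map_eq_flip]
    refine hx _ ?_
    change U (T (U.symm (U y))) = 0
    rw [U.symm_apply_apply, show T y = 0 from hy, map_zero]

end MoorePenrose

/-! ### The Neumann series of (1 - zA)⁻¹. -/

section Resolvent

variable {E : Type*} [NormedAddCommGroup E] [NormedSpace ℂ E]

theorem norm_smul_lt_one_of_mem_ball {A : E →L[ℂ] E} {z : ℂ}
    (hz : z ∈ Metric.ball (0 : ℂ) ‖A‖⁻¹) : ‖z • A‖ < 1 := by
  rw [mem_ball_zero_iff] at hz
  have hA : 0 < ‖A‖ := inv_pos.1 ((norm_nonneg z).trans_lt hz)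
  rw [norm_smul]
  calc ‖z‖ * ‖A‖ < ‖A‖⁻¹ * ‖A‖ := by gcongr
    _ = 1 := inv_mul_cancel₀ hA.ne'

theorem hasSum_inverse_one_sub_smul_apply [CompleteSpace E] {A : E →L[ℂ] E} {z : ℂ}
    (hz : z ∈ Metric.ball (0 : ℂ) ‖A‖⁻¹) (e : E) :
    HasSum (fun k : ℕ => z ^ k • (A ^ k) e) (Ring.inverse (1 - z • A) e) := by
  have h := (hasSum_geom_series_inverse (z • A) (norm_smul_lt_one_of_mem_ball hz)).mapL
    (ContinuousLinearMap.apply ℂ E e)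
  simpa [smul_pow] using h

theorem differentiableOn_inverse_one_sub_smul_apply [CompleteSpace E] (A : E →L[ℂ] E) (e : E) :
    DifferentiableOn ℂ (fun z : ℂ => Ring.inverse (1 - z • A) e) (Metric.ball 0 ‖A‖⁻¹) := by
  intro z hz
  have hu : IsUnit (1 - z • A) := isUnit_one_sub_of_norm_lt_one (norm_smul_lt_one_of_mem_ball hz)
  have h1 : DifferentiableAt ℂ (fun z : ℂ => Ring.inverse (1 - z • A)) z :=
    DifferentiableAt.comp (g := Ring.inverse) z (differentiableAt_inverse hu) (by fun_prop)
  exact (h1.clm_apply (differentiableAt_const e)).differentiableWithinAt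

end Resolvent

/-! ### Construction of the spanning cross-section. -/

section Section

variable {H : Type u} [NormedAddCommGroup H] [InnerProductSpace ℂ H]

/-- If `R A = 1` and `R e = 0`, then `(1 - z A)⁻¹ e` is an eigenvector of `R`. -/
theorem apply_inverse_one_sub_smul [CompleteSpace H] {R A : H →L[ℂ] H} (hRA : ∀ x, R (A x) = x) {e : H}
    (he : R e = 0) {z : ℂ} (hz : z ∈ Metric.ball (0 : ℂ) ‖A‖⁻¹) :
    R (Ring.inverse (1 - z • A) e) = z • Ring.inverse (1 - z • A) e := by
  have hu : IsUnit (1 - z • A) := isUnit_one_sub_of_norm_lt_one (norm_smul_lt_one_of_mem_ball hz)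
  -- Apply `R` to (1 - zA)(1 - zA)⁻¹ e = e.
  have h := congrArg (fun B : H →L[ℂ] H => R (B e)) (Ring.mul_inverse_cancel _ hu)
  simpa [hRA, he, sub_eq_zero] using h

/-- A vector `f` with `S ^ k f ∈ ran T` for all `k` is in the range of every power of `T`. -/
theorem pow_apply_pow_eq_of_mem_range {T S : H →L[ℂ] H} (hST : ∀ x, S (T x) = x) {f : H}
    (hf : ∀ k, (S ^ k) f ∈ T.range) (k : ℕ) : (T ^ k) ((S ^ k) f) = f := by
  induction k with
  | zero => simp
  | succ k ih =>
    obtain ⟨y, hy⟩ := hf k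
    have hy' : T y = (S ^ k) f := hy
    rw [pow_succ' S, pow_succ T, mul_apply_eq_comp, mul_apply_eq_comp,
      ← hy', hST, hy', ih]

theorem exists_isSpanningSection [CompleteSpace H] {T : H →L[ℂ] H} (hT : T.HasLeftInverse)
    (hanalytic : IsAnalyticOperator T) (hker : T.adjoint.ker.FG)
    (hpos : 0 < ‖moorePenrose T‖) :
    ∃ γ : ℂ → H, IsSpanningSection T.adjoint (omegaDisc T) γ := by
  have hS := isMoorePenroseInverse_moorePenrose hT
  set S := moorePenrose T with hSdef
  have hST := hS.apply_apply hT
  set A := S.adjoint with hA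
  have hnorm : ‖A‖ = ‖S‖ := LinearIsometryEquiv.norm_map _ S
  set R := ‖A‖⁻¹ with hRdef
  have hR : 0 < R := by rw [hRdef, hnorm]; positivity
  have hΩ : omegaDisc T = Metric.ball 0 R := by
    ext z
    simp [omegaDisc, hRdef, hnorm, hSdef]
  have hRA : ∀ x, T.adjoint (A x) = x := fun x => by
    refine ext_inner_right ℂ fun y => ?_
    rw [ContinuousLinearMap.adjoint_inner_left, hA, ContinuousLinearMap.adjoint_inner_left, hST]
  obtain ⟨n, e, he⟩ := Submodule.fg_iff_exists_fin_generating_family.1 hker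
  have heker : ∀ i, T.adjoint (e i) = 0 := fun i => by
    have : e i ∈ T.adjoint.ker := he ▸ Submodule.subset_span ⟨i, rfl⟩
    exact this
  have hmaps : Set.MapsTo (fun z : ℂ => z / R) (Metric.ball 0 R) (Metric.ball 0 1) := by
    intro z hz
    simpa [abs_of_pos hR, div_lt_one hR] using hz
  have hψ : DifferentiableOn ℂ (fun z : ℂ => lacunaryProduct (z / R)) (Metric.ball 0 R) :=
    differentiableOn_lacunaryProduct.comp (by fun_prop) hmaps
  refine ⟨fun z => ∑ i : Fin n, lacunaryProduct (z / R) ^ (i : ℕ) •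
    Ring.inverse (1 - z • A) (e i), ?_, ?_, ?_⟩
  · rw [hΩ]
    exact DifferentiableOn.analyticOnNhd (DifferentiableOn.fun_sum fun i _ =>
      (hψ.pow _).smul (differentiableOn_inverse_one_sub_smul_apply A (e i))) Metric.isOpen_ball
  · rw [hΩ]
    intro z hz
    simp only [map_sum, map_smul, Finset.smul_sum,
      apply_inverse_one_sub_smul hRA (heker _) hz]
    exact Finset.sum_congr rfl fun i _ => smul_comm _ _ _
  · rw [hΩ, Submodule.topologicalClosure_eq_top_iff, Submodule.eq_bot_iff]
    intro f hf
    have hcoeff := coeff_eq_zero_of_sum_lacunaryProduct_pow hR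
      (g := fun i z => ⟪f, Ring.inverse (1 - z • A) (e i)⟫_ℂ)
      (a := fun i k => ⟪f, (A ^ k) (e i)⟫_ℂ) (C := fun i => ‖f‖ * ‖e i‖)
      (fun i => (innerSL ℂ f).differentiable.comp_differentiableOn
        (differentiableOn_inverse_one_sub_smul_apply A (e i)))
      (fun i z hz => by
        have h := (hasSum_inverse_one_sub_smul_apply hz (e i)).mapL (innerSL ℂ f)
        simpa [inner_smul_right, mul_comm] using h)
      (fun i k => by
        have h1 : ‖A‖ * R = 1 := mul_inv_cancel₀ (inv_pos.1 hR).ne'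
        calc ‖⟪f, (A ^ k) (e i)⟫_ℂ‖ * R ^ k
            ≤ ‖f‖ * (‖A‖ ^ k * ‖e i‖) * R ^ k := by
              gcongr
              refine (norm_inner_le_norm _ _).trans ?_
              gcongr
              refine ((A ^ k).le_opNorm _).trans ?_
              gcongr
              -- For k = 0 only ‖1‖ ≤ 1 is used, which holds even on the zero space.
              rcases k.eq_zero_or_pos with rfl | hk
              · rw [pow_zero, pow_zero]
                exact ContinuousLinearMap.norm_id_le
              · exact norm_pow_le' A hk
          _ = ‖f‖ * ‖e i‖ * (‖A‖ * R) ^ k := by ring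
          _ = _ := by rw [h1, one_pow, mul_one])
      (fun z hz => by
        have h := Submodule.inner_left_of_mem_orthogonal
          (Submodule.subset_span (Set.mem_image_of_mem _ hz)) hf
        simpa [inner_sum, inner_smul_right] using h)
    -- The vanishing coefficients say S^k f ⟂ ker T* = (ran T)ᗮ, and ran T is closed.
    have hrange : ∀ k, (S ^ k) f ∈ T.range := by
      intro k
      rw [← orthogonal_orthogonal_range hT, ContinuousLinearMap.orthogonal_range, ← he,
        Submodule.mem_orthogonal]
      refine fun u hu => inner_eq_zero_of_mem_span ?_ hu
      rintro _ ⟨i, rfl⟩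
      have hadj : A ^ k = (S ^ k).adjoint := by
        simp only [hA, ← ContinuousLinearMap.star_eq_adjoint, star_pow]
      rw [← ContinuousLinearMap.adjoint_inner_left, ← hadj]
      exact inner_eq_zero_symm.1 (hcoeff i k)
    have hmem : f ∈ ⨅ k : {k : ℕ // 1 ≤ k}, (T ^ (k : ℕ)).range := by
      simp only [Submodule.mem_iInf]
      exact fun k => ⟨_, pow_apply_pow_eq_of_mem_range hST hrange k⟩
    rw [hanalytic] at hmem
    exact hmem

end Section

/-! ### Transport of the Hilbert structure to a space of functions. -/

section FunctionModel

variable {H : Type u} [NormedAddCommGroup H] [InnerProductSpace ℂ H] {X : Type}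

/-- The space of the functions `Φ f`, `f ∈ H`. -/
def FunctionModel (Φ : H →L[ℂ] X → ℂ) : Type u := ULift.{u} Φ.range

namespace FunctionModel

variable (Φ : H →L[ℂ] X → ℂ)

noncomputable instance : AddCommGroup (FunctionModel Φ) :=
  inferInstanceAs (AddCommGroup (ULift.{u} Φ.range))

noncomputable instance : Module ℂ (FunctionModel Φ) :=
  inferInstanceAs (Module ℂ (ULift.{u} Φ.range))

/-- The inclusion of `FunctionModel Φ` into the space of all functions. -/
noncomputable def toFun : FunctionModel Φ →ₗ[ℂ] X → ℂ :=
  Φ.range.subtype ∘ₗ (ULift.moduleEquiv : ULift.{u} Φ.range ≃ₗ[ℂ] Φ.range).toLinearMap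

theorem toFun_injective : Function.Injective (toFun Φ) :=
  Subtype.val_injective.comp ULift.down_injective

variable {Φ}

/-- `f ↦ Φ f` as an isomorphism onto `FunctionModel Φ`. -/
noncomputable def equiv (hΦ : Function.Injective Φ) : H ≃ₗ[ℂ] FunctionModel Φ :=
  (LinearEquiv.ofInjective (Φ : H →ₗ[ℂ] X → ℂ) hΦ).trans
    (ULift.moduleEquiv : ULift.{u} Φ.range ≃ₗ[ℂ] Φ.range).symm

theorem toFun_equiv (hΦ : Function.Injective Φ) (f : H) : toFun Φ (equiv hΦ f) = Φ f := rfl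

/-- The norm on `FunctionModel Φ` that makes `f ↦ Φ f` isometric. -/
noncomputable abbrev normedAddCommGroup (hΦ : Function.Injective Φ) :
    NormedAddCommGroup (FunctionModel Φ) :=
  NormedAddCommGroup.induced _ H (equiv hΦ).symm (equiv hΦ).symm.injective

/-- The inner product on `FunctionModel Φ` that makes `f ↦ Φ f` isometric. -/
noncomputable abbrev innerProductSpace (hΦ : Function.Injective Φ) :
    letI := normedAddCommGroup hΦ
    InnerProductSpace ℂ (FunctionModel Φ) :=
  letI := normedAddCommGroup hΦ
  { norm_smul_le := fun c x => by
      change ‖(equiv hΦ).symm (c • x)‖ ≤ ‖c‖ * ‖(equiv hΦ).symm x‖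
      rw [map_smul, norm_smul]
    inner := fun x y => ⟪(equiv hΦ).symm x, (equiv hΦ).symm y⟫_ℂ
    norm_sq_eq_re_inner := fun x => norm_sq_eq_re_inner (𝕜 := ℂ) ((equiv hΦ).symm x)
    conj_inner_symm := fun x y => inner_conj_symm _ _
    add_left := fun x y z => by
      change ⟪(equiv hΦ).symm (x + y), (equiv hΦ).symm z⟫_ℂ = _
      rw [map_add, inner_add_left]
    smul_left := fun x y c => by
      change ⟪(equiv hΦ).symm (c • x), (equiv hΦ).symm y⟫_ℂ = _
      rw [map_smul, inner_smul_left] }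

end FunctionModel

/-- An injective continuous linear map from a Hilbert space `H` to functions is unitary onto a
reproducing kernel Hilbert space. -/
theorem exists_rkhs_of_injective [CompleteSpace H] (Φ : H →L[ℂ] X → ℂ)
    (hΦ : Function.Injective Φ) :
    ∃ (K : Type u) (_ : NormedAddCommGroup K) (_ : InnerProductSpace ℂ K)
      (_ : CompleteSpace K) (_ : RKHS ℂ K X ℂ) (U : H ≃ₗᵢ[ℂ] K),
      ∀ (f : H) (x : X), U f x = Φ f x := by
  let := FunctionModel.normedAddCommGroup hΦ
  let := FunctionModel.innerProductSpace hΦ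
  let U : H ≃ₗᵢ[ℂ] FunctionModel Φ :=
    { FunctionModel.equiv hΦ with
      norm_map' := fun f => congrArg norm ((FunctionModel.equiv hΦ).symm_apply_apply f) }
  have hcomplete : CompleteSpace (FunctionModel Φ) :=
    (completeSpace_congr (e := U.symm.toLinearEquiv.toEquiv) U.symm.isometry.isUniformEmbedding).2 ‹_›
  have hcoe : ∀ g : FunctionModel Φ, Φ (U.symm g) = FunctionModel.toFun Φ g := fun g => by
    rw [← FunctionModel.toFun_equiv hΦ]
    exact congrArg _ (U.apply_symm_apply g)
  let : RKHS ℂ (FunctionModel Φ) X ℂ :=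
    { coeCLM :=
        { FunctionModel.toFun Φ with
          cont := by
            have : Continuous fun g => Φ (U.symm g) := Φ.continuous.comp U.symm.continuous
            simp only [hcoe] at this
            exact this }
      coeCLM_injective := FunctionModel.toFun_injective Φ }
  exact ⟨FunctionModel Φ, _, _, hcomplete, this, U, fun f x => rfl⟩

end FunctionModel

/-! ### The multiplication model of T. -/

section Main

variable {H : Type u} [NormedAddCommGroup H] [InnerProductSpace ℂ H]

theorem conj_mem_omegaDisc {T : H →L[ℂ] H} {z : ℂ} (hz : z ∈ omegaDisc T) :
    conj z ∈ omegaDisc T := by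
  simpa [omegaDisc] using hz

theorem isOpen_omegaDisc (T : H →L[ℂ] H) : IsOpen (omegaDisc T) :=
  isOpen_lt continuous_norm continuous_const

theorem IsSpanningSection.eq_zero_of_inner [CompleteSpace H] {T R : H →L[ℂ] H} {γ : ℂ → H}
    (hγ : IsSpanningSection R (omegaDisc T) γ) {f : H}
    (hf : ∀ z ∈ omegaDisc T, ⟪γ (conj z), f⟫_ℂ = 0) : f = 0 := by
  have hbot := (Submodule.topologicalClosure_eq_top_iff).1 hγ.spanning
  rw [Submodule.eq_bot_iff] at hbot
  refine hbot f ?_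
  rw [Submodule.mem_orthogonal]
  intro u hu
  refine inner_eq_zero_of_mem_span ?_ hu
  rintro _ ⟨z, hz, rfl⟩
  simpa using hf _ (conj_mem_omegaDisc hz)

/-- The function is z ↦ conj h(conj z) with h = ⟪f, γ ·⟫ holomorphic, and the disc is symmetric
under conjugation. -/
theorem IsSpanningSection.isAnalyticFunction_inner {T R : H →L[ℂ] H} {γ : ℂ → H}
    (hγ : IsSpanningSection R (omegaDisc T) γ) (f : H) :
    IsAnalyticFunction (fun z : omegaDisc T => ⟪γ (conj (z : ℂ)), f⟫_ℂ) := by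
  refine ⟨fun z => ⟪γ (conj z), f⟫_ℂ, ?_, fun z => rfl⟩
  refine DifferentiableOn.analyticOnNhd (fun z hz => ?_) (isOpen_omegaDisc T)
  have hd : DifferentiableAt ℂ (fun z => ⟪f, γ z⟫_ℂ) (conj z) :=
    (innerSL ℂ f).differentiableAt.comp _
      (hγ.holomorphic _ (conj_mem_omegaDisc hz)).differentiableAt
  have hc := hd.conj_conj
  rw [Complex.conj_conj] at hc
  refine (hc.congr_of_eventuallyEq (Filter.Eventually.of_forall fun w => ?_)).differentiableWithinAt
  simp

/-- Needed because 0⁻¹ = 0 would make `omegaDisc T` empty. -/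
theorem moorePenrose_ne_zero [CompleteSpace H] {T : H →L[ℂ] H} (hT : T.HasLeftInverse)
    [Nontrivial H] : moorePenrose T ≠ 0 := by
  intro h0
  obtain ⟨x, hx⟩ := exists_ne (0 : H)
  refine hx ?_
  rw [← (isMoorePenroseInverse_moorePenrose hT).apply_apply hT x, h0,
    zero_apply]

theorem finrank_ker_adjoint_pos [CompleteSpace H] {T : H →L[ℂ] H} {n : ℕ} (hn : 0 < n)
    (hindex : fredholmIndex T = -(n : ℤ)) : 0 < Module.finrank ℂ T.adjoint.ker := by
  unfold fredholmIndex at hindex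
  omega

end Main

theorem mainTheorem8 {H : Type u} [NormedAddCommGroup H] [InnerProductSpace ℂ H]
    [CompleteSpace H] (T : H →L[ℂ] H) (n : ℕ) (hn : 0 < n)
    (hleft : T.HasLeftInverse) (hanalytic : IsAnalyticOperator T)
    (hfredholm : T.IsFredholm) (hindex : fredholmIndex T = -(n : ℤ)) :
    -- spanning holomorphic cross-sections of the eigenspaces of `T*` over `Ω_T` exist, and
    (∃ γ : ℂ → H, IsSpanningSection T.adjoint (omegaDisc T) γ) ∧
    -- each of them gives a model of `T` on a reproducing kernel Hilbert space `K`
    ∀ γ : ℂ → H, IsSpanningSection T.adjoint (omegaDisc T) γ →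
      ∃ (K : Type u) (_ : NormedAddCommGroup K) (_ : InnerProductSpace ℂ K)
        (_ : CompleteSpace K) (_ : RKHS ℂ K (omegaDisc T) ℂ)
        (U : H ≃ₗᵢ[ℂ] K) (Mz : K →L[ℂ] K),
        -- the elements of `K` are the functions `z ↦ ⟨f, γ (conj z)⟩`, and they are analytic
        (∀ (f : H) (z : omegaDisc T), U f z = ⟪γ (conj (z : ℂ)), f⟫_ℂ) ∧
        (∀ g : K, IsAnalyticFunction (fun z : omegaDisc T => g z)) ∧
        -- `Mz` is multiplication by `z`, and `U T U* = Mz`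
        (∀ (g : K) (z : omegaDisc T), Mz g z = (z : ℂ) * g z) ∧
        (∀ f : H, U (T f) = Mz (U f)) ∧
        -- `U T† U* = Mz†`, and `Mz†` is division by `z` on the complement of its kernel
        (∀ f : H, U (moorePenrose T f) = moorePenrose Mz (U f)) ∧
        (∀ g ∈ (moorePenrose Mz).kerᗮ, ∀ z : omegaDisc T,
          (z : ℂ) * moorePenrose Mz g z = g z) := by
  -- Since `finrank` is 0 in infinite dimension, positivity gives both finite dimension and
  -- nontriviality of ker T*.
  have hfin := finrank_ker_adjoint_pos hn hindex
  have : FiniteDimensional ℂ T.adjoint.ker := Module.finite_of_finrank_pos hfin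
  have : Nontrivial T.adjoint.ker := Module.nontrivial_of_finrank_pos hfin
  have : Nontrivial H := T.adjoint.ker.subtype_injective.nontrivial
  refine ⟨exists_isSpanningSection hleft hanalytic
    (Module.Finite.iff_fg.1 inferInstance) (norm_pos_iff.2 (moorePenrose_ne_zero hleft)),
    fun γ hγ => ?_⟩
  let Φ : H →L[ℂ] omegaDisc T → ℂ :=
    ContinuousLinearMap.pi fun z => innerSL ℂ (γ (conj (z : ℂ)))
  have hΦ : Function.Injective Φ := (injective_iff_map_eq_zero Φ).2 fun f hf =>
    hγ.eq_zero_of_inner fun z hz => congrFun hf ⟨z, hz⟩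
  obtain ⟨K, _, _, _, _, U, hU⟩ := exists_rkhs_of_injective Φ hΦ
  have hU' : ∀ (f : H) (z : omegaDisc T), U f z = ⟪γ (conj (z : ℂ)), f⟫_ℂ := hU
  have hS := (isMoorePenroseInverse_moorePenrose hleft).conj U
  set Mz : K →L[ℂ] K := (U : H →L[ℂ] K) ∘L T ∘L (U.symm : K →L[ℂ] H)
  set Sz : K →L[ℂ] K := (U : H →L[ℂ] K) ∘L moorePenrose T ∘L (U.symm : K →L[ℂ] H)
  have hMU : ∀ f, U (T f) = Mz (U f) := fun f =>
    congrArg (fun x => U (T x)) (U.symm_apply_apply f).symm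
  have hSU : ∀ f, U (moorePenrose T f) = Sz (U f) := fun f =>
    congrArg (fun x => U (moorePenrose T x)) (U.symm_apply_apply f).symm
  have hSM : ∀ g, Sz (Mz g) = g := fun g => by
    obtain ⟨f, rfl⟩ := U.surjective g
    rw [← hMU, ← hSU, (isMoorePenroseInverse_moorePenrose hleft).apply_apply hleft]
  have hMz : ∀ (g : K) (z : omegaDisc T), Mz g z = (z : ℂ) * g z := fun g z => by
    obtain ⟨f, rfl⟩ := U.surjective g
    rw [← hMU, hU', hU', ← ContinuousLinearMap.adjoint_inner_left,
      hγ.eigenvector _ (conj_mem_omegaDisc z.2), inner_smul_left, Complex.conj_conj]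
  refine ⟨K, _, _, ‹_›, _, U, Mz, hU', fun g => ?_, hMz, hMU, ?_, ?_⟩
  · obtain ⟨f, rfl⟩ := U.surjective g
    simpa only [hU'] using hγ.isAnalyticFunction_inner f
  · rwa [hS.moorePenrose_eq]
  · intro g hg z
    rw [hS.moorePenrose_eq] at hg ⊢
    -- (ker Mz†)ᗮ = (ran Mz)ᗮᗮ = ran Mz, so g = Mz h and Mz† g = h.
    rw [hS.1, orthogonal_orthogonal_range ⟨Sz, hSM⟩] at hg
    obtain ⟨h, rfl⟩ := hg
    rw [ContinuousLinearMap.coe_coe, hSM, hMz]
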